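/- **Theorem (Feature-Enriched Kolmogorov Superposition Theorem).** Let $n, m \ge 0$ be integers, let $f : [0,1]^n \times \mathbb{R}^m \to \mathbb{R}$ be continuous, and let $u_1, \dots, u_m : [0,1]^n \to \mathbb{R}$ be continuous functions (the features). Then there exist continuous functions $\phi_i : \mathbb{R} \to \mathbb{R}$, $i = 1, \dots, 2(n+m)+1$, and continuous functions $\psi_{i,q} : \mathbb{R} \to \mathbb{R}$, $i = 1, \dots, 2(n+m)+1$, $q = 1, \dots, n+m$, such that for all $\mathbf{x} = (x_1, \dots, x_n) \in [0,1]^n$ $$ f\big(\mathbf{x}, u_1(\mathbf{x}), \dots, u_m(\mathbf{x})\big) = \sum_{i=1}^{2(n+m)+1} \phi_i\Big( \sum_{q=1}^{n} \psi_{i,q}(x_q) + \sum_{j=1}^{m} \psi_{i,n+j}(u_j(\mathbf{x})) \Big). $$ -/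

import Mathlib

open scoped BoundedContinuousFunction

/-! Treat the features as `m` extra variables rescaled to `[0,1]`; this reduces the claim to
Kolmogorov's theorem in `N = n + m` variables, proved by Baire category. For fixed nonzero `F`, the
inner functions admitting bounded outer functions with a definite relative gain on `F` form an open
set. It is dense (`dense_approximatingInner`): inner functions can be perturbed to separate small
cubes, and each point lies in cubes of at least `N + 1` of the `2N + 1` families. A choice good for
a dense sequence of `F` makes the superposition operator surjective, by iterating on the residual.
-/

/-- The unit interval admits `L` families of small disjoint closed sets such that every point is
missed by at most one family. -/
theorem grid_cover (L : ℕ) {ε : ℝ} (hε : 0 < ε) :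
    ∃ (B : ℕ) (C : Fin L → Fin B → Set unitInterval), 0 < B ∧
      (∀ i k, IsClosed (C i k)) ∧
      (∀ i k l x, x ∈ C i k → x ∈ C i l → k = l) ∧
      (∀ i k, ∀ x ∈ C i k, ∀ y ∈ C i k, dist x y < ε) ∧
      ∀ x i j, (∀ k, x ∉ C i k) → (∀ k, x ∉ C j k) → i = j := by
  obtain ⟨M, hM⟩ := exists_nat_one_div_lt hε
  -- In the variable `t = (M + 1) * L * x` the sets have length `L - 1`, and family `i` misses
  -- exactly the `t` strictly between integers `a` and `a + 1` with `a ≡ i` mod `L`.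
  refine ⟨M + 2, fun i k => {x | ((k : ℝ) - 1) * L + i + 1 ≤ (M + 1) * L * (x : ℝ) ∧
    (M + 1) * L * (x : ℝ) ≤ k * L + i}, by omega, ?_, ?_, ?_, ?_⟩
  · intro i k
    simp only [Set.ofPred_and]
    exact IsClosed.inter (isClosed_le (by fun_prop) (by fun_prop))
      (isClosed_le (by fun_prop) (by fun_prop))
  · have key : ∀ (i : Fin L) (k l : Fin (M + 2)) (t : ℝ), t ≤ k * L + i →
        ((l : ℝ) - 1) * L + i + 1 ≤ t → ¬ (k : ℕ) < l := by
      intro i k l t h1 h2 hkl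
      have h3 : ((k : ℕ) : ℝ) + 1 ≤ (l : ℕ) := by exact_mod_cast hkl
      have h4 : (0 : ℝ) ≤ L := by positivity
      nlinarith
    intro i k l x hk hl
    have h1 := key i k l _ hk.2 hl.1
    have h2 := key i l k _ hl.2 hk.1
    exact Fin.ext (by omega)
  · intro i k x hx y hy
    have hL : (0 : ℝ) < L := by exact_mod_cast i.pos
    have h4 : (M + 1) * L * |(x : ℝ) - y| ≤ L - 1 := by
      rw [← abs_of_nonneg (by positivity : (0 : ℝ) ≤ (M + 1) * L), ← abs_mul, abs_le]
      obtain ⟨a, b⟩ := hx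
      obtain ⟨c, d⟩ := hy
      constructor <;> linarith
    have h5 : |(x : ℝ) - y| < 1 / (M + 1) := by
      rw [lt_div_iff₀ (by positivity)]
      by_contra! h
      nlinarith
    exact h5.trans hM
  · have key : ∀ (x : unitInterval) (i : Fin L), (∀ k : Fin (M + 2), ¬ (((k : ℝ) - 1) * L + i + 1 ≤
        (M + 1) * L * (x : ℝ) ∧ (M + 1) * L * (x : ℝ) ≤ k * L + i)) →
        ⌊(M + 1) * L * (x : ℝ)⌋₊ % L = i := by
      intro x i h
      have hL : 0 < L := i.pos
      have hi := i.isLt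
      have hL' : (0 : ℝ) < L := by exact_mod_cast hL
      set t : ℝ := (M + 1) * L * (x : ℝ) with ht
      have ht0 : 0 ≤ t := mul_nonneg (by positivity) x.2.1
      have ht1 : t ≤ ((M + 1) * L : ℕ) := by
        push_cast
        exact mul_le_of_le_one_right (by positivity) x.2.2
      have hn1 := Nat.floor_le ht0
      have hn2 := Nat.lt_floor_add_one t
      have hn3 : ⌊t⌋₊ ≤ (M + 1) * L := Nat.floor_le_of_le ht1
      set p := ⌊t⌋₊
      obtain ⟨k, r, hr, hkr⟩ : ∃ k r, r < L ∧ p + L - 1 - i = k * L + r :=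
        ⟨_, _, Nat.mod_lt _ hL, (Nat.div_add_mod' _ _).symm⟩
      have hk : k < M + 2 := by
        by_contra! hk
        have : (M + 2) * L ≤ k * L := Nat.mul_le_mul_right _ hk
        have : (M + 2) * L = (M + 1) * L + L := by ring
        omega
      have hlow : k * L + i + 1 ≤ p + L := by omega
      have hup : p ≤ k * L + i := by omega
      have h1 := h ⟨k, hk⟩
      have hlow' : (k : ℝ) * L + i + 1 ≤ p + L := by exact_mod_cast hlow
      rcases hup.lt_or_eq with hlt | heq
      · have : (p : ℝ) + 1 ≤ k * L + i := by exact_mod_cast hlt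
        exact absurd ⟨by dsimp only; linarith, by dsimp only; linarith⟩ h1
      · rw [heq, Nat.mul_add_mod', Nat.mod_eq_of_lt hi]
    intro x i j hi hj
    exact Fin.ext ((key x i hi).symm.trans (key x j hj))

/-- Round each value down to a multiple of `δ / 2` and add a fraction of `δ / 2` encoding `k` as the
base-`B` digit in place `q`. In units of `δ / 2`, the fractional part of the sum recovers all digits
of `κ`. -/
theorem exists_perturbation_sum_injective {N B : ℕ} (hB : 0 < B) (a : Fin N → Fin B → ℝ) {δ : ℝ}
    (hδ : 0 < δ) : ∃ c : Fin N → Fin B → ℝ, (∀ q k, |c q k - a q k| ≤ δ) ∧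
      Function.Injective fun κ : Fin N → Fin B => ∑ q, c q (κ q) := by
  have hBN : (0 : ℝ) < (B : ℝ) ^ N := by positivity
  refine ⟨fun q k => δ / 2 * (⌊a q k / (δ / 2)⌋ + (k * B ^ (q : ℕ) : ℕ) / (B : ℝ) ^ N), ?_, ?_⟩
  · intro q k
    have h1 := Int.floor_le (a q k / (δ / 2))
    have h2 := Int.lt_floor_add_one (a q k / (δ / 2))
    rw [le_div_iff₀ (by positivity)] at h1
    rw [div_lt_iff₀ (by positivity)] at h2
    have h3 : (((k * B ^ (q : ℕ) : ℕ) : ℝ)) / (B : ℝ) ^ N ≤ 1 := by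
      rw [div_le_one hBN]
      norm_cast
      calc (k : ℕ) * B ^ (q : ℕ) ≤ B * B ^ (q : ℕ) := by gcongr; exact k.2.le
        _ = B ^ ((q : ℕ) + 1) := by ring
        _ ≤ B ^ N := Nat.pow_le_pow_right hB q.2
    have h4 : 0 ≤ (((k * B ^ (q : ℕ) : ℕ) : ℝ)) / (B : ℝ) ^ N := by positivity
    rw [abs_le]
    constructor <;> nlinarith
  · intro κ μ h
    have hsum : ∀ κ : Fin N → Fin B, ∑ q, δ / 2 * ((⌊a q (κ q) / (δ / 2)⌋ : ℝ) +
        (κ q * B ^ (q : ℕ) : ℕ) / (B : ℝ) ^ N) =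
        δ / 2 * (((∑ q, ⌊a q (κ q) / (δ / 2)⌋ : ℤ) : ℝ) +
          ((finFunctionFinEquiv κ : ℕ) : ℝ) / (B : ℝ) ^ N) := by
      intro κ
      rw [← Finset.mul_sum, Finset.sum_add_distrib, finFunctionFinEquiv_apply, ← Finset.sum_div]
      push_cast
      rfl
    dsimp only at h
    rw [hsum, hsum] at h
    have h' := mul_left_cancel₀ (by positivity) h
    have hfr : ∀ κ : Fin N → Fin B, Int.fract ((finFunctionFinEquiv κ : ℕ) / (B : ℝ) ^ N) =
        (finFunctionFinEquiv κ : ℕ) / (B : ℝ) ^ N := by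
      intro κ
      rw [Int.fract_eq_self, div_lt_one hBN]
      exact ⟨by positivity, by exact_mod_cast (finFunctionFinEquiv κ).2⟩
    have h2 := congrArg Int.fract h'
    rw [Int.fract_intCast_add, Int.fract_intCast_add, hfr, hfr,
      div_left_inj' hBN.ne', Nat.cast_inj] at h2
    exact finFunctionFinEquiv.injective (Fin.ext h2)

/-- A bounded operator on a complete space that solves every equation up to a fixed relative error
is surjective. -/
theorem ContinuousLinearMap.surjective_of_approx {E F : Type*} [NormedAddCommGroup E]
    [NormedSpace ℝ E] [CompleteSpace E] [NormedAddCommGroup F] [NormedSpace ℝ F] (T : E →L[ℝ] F)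
    {K θ : ℝ} (hθ0 : 0 ≤ θ) (hθ1 : θ < 1)
    (h : ∀ y, ∃ x, ‖x‖ ≤ K * ‖y‖ ∧ ‖y - T x‖ ≤ θ * ‖y‖) : Function.Surjective T := by
  choose G hG1 hG2 using h
  intro y
  -- `Y r` is the residual after `r` corrections.
  set Y : ℕ → F := fun r => (fun z => z - T (G z))^[r] y with hY
  have hsucc : ∀ r, Y (r + 1) = Y r - T (G (Y r)) := fun r => Function.iterate_succ_apply' _ _ _
  have hnorm : ∀ r, ‖Y r‖ ≤ θ ^ r * ‖y‖ := by
    intro r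
    induction r with
    | zero => simp [hY]
    | succ r ih =>
      rw [hsucc, pow_succ', mul_assoc]
      exact (hG2 _).trans (mul_le_mul_of_nonneg_left ih hθ0)
  have hs : Summable fun r => G (Y r) := by
    refine Summable.of_norm_bounded (g := fun r => θ ^ r * (|K| * ‖y‖))
      ((summable_geometric_of_lt_one hθ0 hθ1).mul_right _) fun r => ?_
    calc ‖G (Y r)‖ ≤ K * ‖Y r‖ := hG1 _
      _ ≤ |K| * (θ ^ r * ‖y‖) :=
        mul_le_mul (le_abs_self K) (hnorm r) (norm_nonneg _) (abs_nonneg _)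
      _ = _ := by ring
  refine ⟨∑' r, G (Y r), ?_⟩
  have h1 := (T.hasSum hs.hasSum).tendsto_sum_nat
  have h2 : ∀ n, ∑ r ∈ Finset.range n, T (G (Y r)) = y - Y n := by
    intro n
    induction n with
    | zero => simp [hY]
    | succ n ih => rw [Finset.sum_range_succ, ih, hsucc]; abel
  have h3 : Filter.Tendsto Y Filter.atTop (nhds 0) := by
    refine squeeze_zero_norm hnorm ?_
    simpa using (tendsto_pow_atTop_nhds_zero_of_lt_one hθ0 hθ1).mul_const ‖y‖
  simp only [h2] at h1
  refine tendsto_nhds_unique h1 ?_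
  simpa using tendsto_const_nhds.sub h3

/-- Applying Tietze to the correction `c - p`, not to the prescribed values, preserves the bound
`δ`. -/
theorem exists_extension_step {X : Type*} [TopologicalSpace X] [CompactSpace X] [T2Space X]
    {B : ℕ} {C : Fin B → Set X} (hC : ∀ k, IsClosed (C k))
    (hdisj : ∀ k l x, x ∈ C k → x ∈ C l → k = l) (c : Fin B → ℝ) (p : C(X, ℝ)) {δ : ℝ}
    (hδ : 0 ≤ δ) (hc : ∀ k, ∀ x ∈ C k, |c k - p x| ≤ δ) :
    ∃ p' : C(X, ℝ), (∀ x, |p' x - p x| ≤ δ) ∧ ∀ k, ∀ x ∈ C k, p' x = c k := by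
  have hcomp : ∀ k, CompactSpace (C k) := fun k =>
    isCompact_iff_compactSpace.mp (hC k).isCompact
  let e : (Σ k, C k) → X := fun y => y.2
  have he : Continuous e := continuous_sigma fun k => continuous_subtype_val
  have hinj : Function.Injective e := by
    rintro ⟨k, x, hx⟩ ⟨l, y, hy⟩ (h : x = y)
    subst h
    obtain rfl := hdisj k l x hx hy
    rfl
  let d : C((Σ k, C k), ℝ) := ⟨fun y => c y.1 - p y.2, by
    refine continuous_sigma fun k => ?_
    fun_prop⟩
  obtain ⟨D, hD, hDe⟩ :=
    d.exists_extension_forall_mem_of_isClosedEmbedding (t := Set.Icc (-δ) δ)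
      (fun y => abs_le.mp (hc y.1 y.2 y.2.2)) ⟨0, by simpa using hδ⟩ (he.isClosedEmbedding hinj)
  refine ⟨p + D, fun x => ?_, fun k x hx => ?_⟩
  · simpa using abs_le.mpr (hD x)
  · have : D x = c k - p x := congrFun hDe ⟨k, x, hx⟩
    simp [this]

/-- The superposition `x ↦ ∑ q, p q (x q)` of functions of one variable. -/
def ContinuousMap.coordSum {X : Type*} [TopologicalSpace X] {N : ℕ} (p : Fin N → C(X, ℝ)) :
    C(Fin N → X, ℝ) :=
  ∑ q, (p q).comp ⟨fun x => x q, continuous_apply q⟩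

theorem ContinuousMap.coordSum_apply {X : Type*} [TopologicalSpace X] {N : ℕ}
    (p : Fin N → C(X, ℝ)) (x : Fin N → X) : coordSum p x = ∑ q, p q (x q) := by
  simp [coordSum]

theorem ContinuousMap.continuous_coordSum {X : Type*} [TopologicalSpace X] {N : ℕ} :
    Continuous (coordSum : (Fin N → C(X, ℝ)) → C(Fin N → X, ℝ)) :=
  continuous_finsetSum _ fun q _ =>
    (ContinuousMap.continuous_precomp _).comp (continuous_apply q)

-- Once `p'` is constant on each piece and the sums separate the cubes, `g` need only take sampled
-- values of `F` at finitely many reals; Tietze extends it with the same bound.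
open ContinuousMap in
theorem exists_perturbation_approx_on_cubes {X : Type*} [MetricSpace X] [CompactSpace X]
    [Nonempty X] {N B : ℕ} (hB : 0 < B) {C : Fin B → Set X} (hC : ∀ k, IsClosed (C k))
    (hdisj : ∀ k l x, x ∈ C k → x ∈ C l → k = l) (p : Fin N → C(X, ℝ)) (F : C(Fin N → X, ℝ))
    {δ η ε : ℝ} (hδ : 0 < δ) (hε : 0 < ε) (hsmall : ∀ k, ∀ x ∈ C k, ∀ y ∈ C k, dist x y < ε)
    (hp : ∀ q x y, dist x y < ε → |p q x - p q y| ≤ δ / 2)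
    (hF : ∀ x y, dist x y < ε → |F x - F y| ≤ η) :
    ∃ (p' : Fin N → C(X, ℝ)) (g : ℝ →ᵇ ℝ), (∀ q, dist (p' q) (p q) ≤ δ) ∧ ‖g‖ ≤ ‖F‖ ∧
      ∀ x, (∀ q, ∃ k, x q ∈ C k) → |F x - g (coordSum p' x)| ≤ η := by
  classical
  have hz : ∀ k, ∃ z : X, (C k).Nonempty → z ∈ C k := fun k => by
    by_cases h : (C k).Nonempty
    · exact ⟨h.some, fun _ => h.some_mem⟩
    · exact ⟨Classical.arbitrary X, fun h' => absurd h' h⟩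
  choose z hz using hz
  obtain ⟨c, hc, hinj⟩ := exists_perturbation_sum_injective hB (fun q k => p q (z k)) (half_pos hδ)
  have hstep : ∀ q, ∃ p' : C(X, ℝ), (∀ x, |p' x - p q x| ≤ δ) ∧ ∀ k, ∀ x ∈ C k, p' x = c q k := by
    intro q
    refine exists_extension_step hC hdisj (c q) (p q) hδ.le fun k x hx => ?_
    have h1 := hc q k
    have h2 := hp q (z k) x (hsmall k _ (hz k ⟨x, hx⟩) _ hx)
    calc |c q k - p q x| ≤ |c q k - p q (z k)| + |p q (z k) - p q x| := abs_sub_le _ _ _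
      _ ≤ δ := by linarith
  choose p' hp' hpc using hstep
  let v : C(Fin N → Fin B, ℝ) := ⟨fun κ => F fun q => z (κ q), continuous_of_discreteTopology⟩
  obtain ⟨g, hg, hge⟩ := v.exists_extension_forall_mem_of_isClosedEmbedding
    (t := Set.Icc (-‖F‖) ‖F‖) (fun κ => abs_le.mp (F.norm_coe_le_norm _)) ⟨0, by simp⟩
    ((continuous_of_discreteTopology (f := fun κ : Fin N → Fin B => ∑ q, c q (κ q))).isClosedEmbedding
      hinj)
  refine ⟨p', BoundedContinuousFunction.ofNormedAddCommGroup g g.continuous ‖F‖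
    fun t => abs_le.mpr (hg t), fun q => ?_, ?_, fun x hx => ?_⟩
  · exact (ContinuousMap.dist_le hδ.le).mpr fun x => hp' q x
  · exact (BoundedContinuousFunction.norm_le (norm_nonneg F)).mpr fun t => abs_le.mpr (hg t)
  · choose κ hκ using hx
    have h1 : coordSum p' x = ∑ q, c q (κ q) := by
      rw [coordSum_apply]
      exact Finset.sum_congr rfl fun q _ => hpc q _ _ (hκ q)
    have h2 : g (∑ q, c q (κ q)) = F fun q => z (κ q) := congrFun hge κ
    rw [BoundedContinuousFunction.coe_ofNormedAddCommGroup, h1, h2]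
    exact hF _ _ ((dist_pi_lt_iff hε).mpr fun q => hsmall _ _ (hκ q) _ (hz _ ⟨_, hκ q⟩))

/-! ### The superposition operator and the Baire category argument -/

/-- The linear map sending outer functions `g` to the superposition `∑ i, g i ∘ s i`. -/
noncomputable def superposition {ι X : Type*} [Fintype ι] [TopologicalSpace X] [CompactSpace X]
    (s : ι → C(X, ℝ)) : (ι → ℝ →ᵇ ℝ) →L[ℝ] C(X, ℝ) :=
  LinearMap.mkContinuous
    { toFun := fun g => ∑ i, (g i : C(ℝ, ℝ)).comp (s i)
      map_add' := fun g h => by ext x; simp [Finset.sum_add_distrib]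
      map_smul' := fun a g => by ext x; simp [Finset.mul_sum] }
    (Fintype.card ι) fun g => by
      refine (ContinuousMap.norm_le _ (by positivity)).mpr fun x => ?_
      simp only [LinearMap.coe_mk, AddHom.coe_mk, ContinuousMap.coe_sum, Finset.sum_apply]
      refine (norm_sum_le_of_le _ fun i _ =>
        ((g i).norm_coe_le_norm _).trans (norm_le_pi_norm g i)).trans ?_
      simp

theorem superposition_apply {ι X : Type*} [Fintype ι] [TopologicalSpace X] [CompactSpace X]
    (s : ι → C(X, ℝ)) (g : ι → ℝ →ᵇ ℝ) (x : X) : superposition s g x = ∑ i, g i (s i x) := by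
  simp [superposition]

theorem continuous_superposition {ι X : Type*} [Fintype ι] [TopologicalSpace X] [CompactSpace X]
    (g : ι → ℝ →ᵇ ℝ) : Continuous fun s : ι → C(X, ℝ) => superposition s g :=
  continuous_finsetSum _ fun i _ =>
    (ContinuousMap.continuous_postcomp _).comp (continuous_apply i)

/-- Inner functions that allow `F` to be approximated with a definite relative gain. -/
def approximatingInner (N : ℕ) (F : C(Fin N → unitInterval, ℝ)) :
    Set (Fin (2 * N + 1) → Fin N → C(unitInterval, ℝ)) :=
  {p | ∃ g : Fin (2 * N + 1) → ℝ →ᵇ ℝ, ‖g‖ ≤ ‖F‖ ∧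
    ‖F - superposition (fun i => ContinuousMap.coordSum (p i)) g‖ < (2 * N + 1) / (2 * N + 2) * ‖F‖}

theorem isOpen_approximatingInner (N : ℕ) (F : C(Fin N → unitInterval, ℝ)) :
    IsOpen (approximatingInner N F) := by
  simp only [approximatingInner, Set.ofPred_exists, Set.ofPred_and]
  refine isOpen_iUnion fun g => isOpen_const.inter (isOpen_lt ?_ continuous_const)
  refine (continuous_const.sub ((continuous_superposition g).comp ?_)).norm
  exact continuous_pi fun i => ContinuousMap.continuous_coordSum.comp (continuous_apply i)

open ContinuousMap in
theorem dense_approximatingInner (N : ℕ) {F : C(Fin N → unitInterval, ℝ)} (hF0 : F ≠ 0) :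
    Dense (approximatingInner N F) := by
  classical
  rw [Metric.dense_iff]
  intro p δ hδ
  have hFpos : 0 < ‖F‖ := norm_pos_iff.mpr hF0
  set η : ℝ := ‖F‖ / (4 * (N + 1)) with hη
  have hηpos : 0 < η := by positivity
  obtain ⟨ε₁, hε₁, h1⟩ := Metric.uniformContinuous_iff.mp
    (CompactSpace.uniformContinuous_of_continuous F.continuous) η hηpos
  have h2 : ∀ i q, ∃ ε > 0, ∀ x y, dist x y < ε → |p i q x - p i q y| ≤ δ / 2 / 2 := fun i q => by
    obtain ⟨ε, hε, h⟩ := Metric.uniformContinuous_iff.mp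
      (CompactSpace.uniformContinuous_of_continuous (p i q).continuous) (δ / 2 / 2) (by positivity)
    exact ⟨ε, hε, fun x y hxy => (h hxy).le⟩
  choose ε' hε' h2 using h2
  obtain ⟨ε, hε, hle1, hle2⟩ : ∃ ε > 0, ε ≤ ε₁ ∧ ∀ i q, ε ≤ ε' i q := by
    obtain ⟨ε₂, h, h'⟩ : ∃ ε₂ > 0, ∀ iq : Fin (2 * N + 1) × Fin N, ε₂ ≤ ε' iq.1 iq.2 := by
      rcases isEmpty_or_nonempty (Fin (2 * N + 1) × Fin N) with he | he
      · exact ⟨1, one_pos, fun iq => he.elim iq⟩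
      · obtain ⟨a, ha⟩ := Finite.exists_min fun iq : Fin (2 * N + 1) × Fin N => ε' iq.1 iq.2
        exact ⟨_, hε' a.1 a.2, ha⟩
    exact ⟨min ε₁ ε₂, lt_min hε₁ h, min_le_left _ _, fun i q => (min_le_right _ _).trans (h' (i, q))⟩
  obtain ⟨B, C, hB, hC, hdisj, hsmall, hcov⟩ := grid_cover (2 * N + 1) hε
  have hfam := fun i => exists_perturbation_approx_on_cubes hB (hC i) (hdisj i) (p i) F
    (half_pos hδ) hε (hsmall i) (fun q x y hxy => h2 i q x y (hxy.trans_le (hle2 i q)))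
    (fun x y hxy => (h1 (hxy.trans_le hle1)).le)
  choose p' g hp' hg happ using hfam
  -- With weight `1 / (N + 1)`, any `N + 1` good families reproduce `F x` up to `η`, and the other
  -- `N` contribute at most `N / (N + 1) * ‖F‖`.
  refine ⟨p', ?_, fun i => ((N : ℝ) + 1)⁻¹ • g i, ?_, ?_⟩
  · rw [Metric.mem_ball]
    exact ((dist_pi_le_iff (half_pos hδ).le).mpr fun i =>
      (dist_pi_le_iff (half_pos hδ).le).mpr (hp' i)).trans_lt (half_lt_self hδ)
  · refine (pi_norm_le_iff_of_nonneg hFpos.le).mpr fun i => ?_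
    rw [norm_smul, norm_inv, Real.norm_of_nonneg (by positivity)]
    refine (mul_le_of_le_one_left (norm_nonneg _) (inv_le_one_of_one_le₀ ?_)).trans (hg i)
    linarith [(Nat.cast_nonneg N : (0 : ℝ) ≤ N)]
  · have hgoal : N / (N + 1) * ‖F‖ + η < (2 * N + 1) / (2 * N + 2) * ‖F‖ := by
      have : (2 * N + 1) / (2 * N + 2) * ‖F‖ = N / (N + 1) * ‖F‖ + 2 * η := by
        rw [hη]; field_simp; ring
      linarith
    refine lt_of_le_of_lt ((ContinuousMap.norm_le _ (by positivity)).mpr fun x => ?_) hgoal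
    set bad : Finset (Fin (2 * N + 1)) := {i | ∃ q, ∀ k, x q ∉ C i k} with hbad
    -- Each coordinate of `x` is missed by at most one family.
    have hcard : bad.card ≤ N := by
      have hq : ∀ i : bad, ∃ q, ∀ k, x q ∉ C i k := fun i =>
        (Finset.mem_filter.mp i.2).2
      choose q hq using hq
      have := Fintype.card_le_of_injective q fun i j hij =>
        Subtype.ext (hcov (x (q i)) i j (hq i) (hij ▸ hq j))
      simpa using this
    obtain ⟨S, hS, hScard⟩ := Finset.exists_subset_card_eq (s := badᶜ) (n := N + 1) (by
      rw [Finset.card_compl, Fintype.card_fin]; omega)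
    have hSc : Sᶜ.card = N := by rw [Finset.card_compl, Fintype.card_fin, hScard]; omega
    rw [ContinuousMap.sub_apply, superposition_apply, ← Finset.sum_add_sum_compl S]
    have hN : ((N : ℝ) + 1) ≠ 0 := by positivity
    have hsplit : F x = ∑ i ∈ S, ((N : ℝ) + 1)⁻¹ * F x := by
      rw [Finset.sum_const, hScard, nsmul_eq_mul]; push_cast; field_simp
    have hA : |F x - ∑ i ∈ S, (((N : ℝ) + 1)⁻¹ • g i) (coordSum (p' i) x)| ≤ η := by
      conv_lhs => rw [hsplit]
      rw [← Finset.sum_sub_distrib]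
      calc _ ≤ ∑ i ∈ S, ((N : ℝ) + 1)⁻¹ * η := by
            refine (Finset.abs_sum_le_sum_abs _ _).trans (Finset.sum_le_sum fun i hi => ?_)
            rw [BoundedContinuousFunction.smul_apply, smul_eq_mul, ← mul_sub, abs_mul,
              abs_of_nonneg (by positivity)]
            refine mul_le_mul_of_nonneg_left (happ i x ?_) (by positivity)
            simpa [hbad] using hS hi
        _ = η := by
            rw [Finset.sum_const, hScard, nsmul_eq_mul]; push_cast; field_simp
    have hBd : |∑ i ∈ Sᶜ, (((N : ℝ) + 1)⁻¹ • g i) (coordSum (p' i) x)| ≤ N / (N + 1) * ‖F‖ := by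
      calc _ ≤ ∑ i ∈ Sᶜ, ((N : ℝ) + 1)⁻¹ * ‖F‖ := by
            refine (Finset.abs_sum_le_sum_abs _ _).trans (Finset.sum_le_sum fun i _ => ?_)
            rw [BoundedContinuousFunction.smul_apply, smul_eq_mul, abs_mul,
              abs_of_nonneg (by positivity)]
            exact mul_le_mul_of_nonneg_left (((g i).norm_coe_le_norm _).trans (hg i))
              (by positivity)
        _ = _ := by
            rw [Finset.sum_const, hSc, nsmul_eq_mul]; field_simp
    rw [Real.norm_eq_abs, ← sub_sub]
    exact (abs_sub _ _).trans (by linarith)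

/-- Kolmogorov's superposition theorem, with inner functions independent of the represented
function. -/
theorem kolmogorov_superposition (N : ℕ) :
    ∃ p : Fin (2 * N + 1) → Fin N → C(unitInterval, ℝ), ∀ F : C(Fin N → unitInterval, ℝ),
      ∃ g : Fin (2 * N + 1) → ℝ →ᵇ ℝ, ∀ x, F x = ∑ i, g i (∑ q, p i q (x q)) := by
  have : CompleteSpace (Fin (2 * N + 1) → Fin N → C(unitInterval, ℝ)) := Pi.complete _
  have : BaireSpace (Fin (2 * N + 1) → Fin N → C(unitInterval, ℝ)) :=
    @BaireSpace.of_completelyPseudoMetrizable _ _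
      (@TopologicalSpace.IsCompletelyPseudoMetrizableSpace.of_completeSpace_pseudometrizable _ _ _ _)
  let D := TopologicalSpace.denseSeq C(Fin N → unitInterval, ℝ)
  -- `D n = 0` is excluded because the strict inequality in `approximatingInner` fails there.
  have hdense : Dense (⋂ n, {p | D n ≠ 0 → p ∈ approximatingInner N (D n)}) := by
    refine dense_iInter_of_isOpen_nat (fun n => ?_) fun n => ?_ <;> by_cases h : D n = 0
    · simp [h]
    · simpa [h] using isOpen_approximatingInner N (D n)
    · simp [h]
    · simpa [h] using dense_approximatingInner N h
  obtain ⟨p, hp⟩ := hdense.nonempty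
  rw [Set.mem_iInter] at hp
  refine ⟨p, fun F => ?_⟩
  set T := superposition fun i => ContinuousMap.coordSum (p i)
  suffices hT : Function.Surjective T by
    obtain ⟨g, hg⟩ := hT F
    refine ⟨g, fun x => ?_⟩
    simp [← hg, T, superposition_apply, ContinuousMap.coordSum_apply]
  set θ : ℝ := (2 * N + 1) / (2 * N + 2) with hθ
  have hθ0 : 0 ≤ θ := by positivity
  have hθ1 : θ < 1 := by rw [hθ, div_lt_one (by positivity)]; linarith
  refine T.surjective_of_approx (K := 2) (θ := (1 + θ) / 2) (by linarith) (by linarith) fun F => ?_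
  rcases eq_or_ne F 0 with rfl | hF
  · exact ⟨0, by simp⟩
  have hFpos : 0 < ‖F‖ := norm_pos_iff.mpr hF
  -- Passing from `F` to `D n` costs at most `2 * ρ`, which raises the factor `θ` to `(1 + θ) / 2`.
  set ρ := (1 - θ) / 4 * ‖F‖ with hρ
  obtain ⟨n, hn⟩ : ∃ n, dist F (D n) < ρ :=
    (TopologicalSpace.denseRange_denseSeq _).exists_dist_lt F
      (mul_pos (by linarith) hFpos)
  rw [dist_eq_norm] at hn
  have hDF : ‖D n‖ ≤ ‖F‖ + ρ := by
    have := norm_sub_norm_le (D n) F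
    rw [norm_sub_rev] at this
    linarith
  have hD0 : D n ≠ 0 := by
    intro h
    rw [h, sub_zero] at hn
    nlinarith
  obtain ⟨g, hg1, hg2⟩ := hp n hD0
  refine ⟨g, by nlinarith, ?_⟩
  calc ‖F - T g‖ = ‖(F - D n) + (D n - T g)‖ := by rw [sub_add_sub_cancel]
    _ ≤ ‖F - D n‖ + ‖D n - T g‖ := norm_add_le _ _
    _ ≤ ρ + θ * (‖F‖ + ρ) :=
      add_le_add hn.le (hg2.le.trans (mul_le_mul_of_nonneg_left hDF hθ0))
    _ ≤ (1 + θ) / 2 * ‖F‖ := by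
      have : θ * ρ ≤ ρ := mul_le_of_le_one_left (by rw [hρ]; nlinarith) hθ1.le
      rw [hρ] at this ⊢
      linarith

/-! ### Reduction of features to variables -/

theorem theorem1 (n m : ℕ)
    (f : (Fin n → unitInterval) × (Fin m → ℝ) → ℝ) (hf : Continuous f)
    (u : Fin m → (Fin n → unitInterval) → ℝ) (hu : ∀ j : Fin m, Continuous (u j)) :
    ∃ (φ : Fin (2 * (n + m) + 1) → ℝ → ℝ)
      (ψ : Fin (2 * (n + m) + 1) → Fin (n + m) → ℝ → ℝ),
      (∀ i, Continuous (φ i)) ∧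
      (∀ i q, Continuous (ψ i q)) ∧
      ∀ x : Fin n → unitInterval,
        f (x, fun j => u j x) =
          ∑ i : Fin (2 * (n + m) + 1),
            φ i ((∑ q : Fin n, ψ i (Fin.castAdd m q) (x q : ℝ)) +
              ∑ j : Fin m, ψ i (Fin.natAdd n j) (u j x)) := by
  let U : C(Fin n → unitInterval, Fin m → ℝ) := ⟨fun x j => u j x, continuous_pi hu⟩
  set R : ℝ := ‖U‖ + 1 with hR
  have hRpos : 0 < R := by positivity
  have huR : ∀ j x, |u j x| ≤ R := fun j x =>
    ((norm_le_pi_norm (U x) j).trans (U.norm_coe_le_norm x)).trans (by linarith)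
  obtain ⟨p, hp⟩ := kolmogorov_superposition (n + m)
  obtain ⟨g, hg⟩ := hp ⟨fun y => f (fun q => y (Fin.castAdd m q),
    fun j => 2 * R * (y (Fin.natAdd n j) : ℝ) - R), by fun_prop⟩
  let proj : ℝ → unitInterval := Set.projIcc 0 1 zero_le_one
  have hproj : Continuous proj := continuous_projIcc
  -- `ψ` absorbs the rescaling of `[-R, R]` to `[0,1]`; `proj` extends the inner functions
  -- continuously to `ℝ`.
  refine ⟨fun i => g i, fun i => Fin.append (fun q t => p i (Fin.castAdd m q) (proj t))
    fun j t => p i (Fin.natAdd n j) (proj ((t + R) / (2 * R))), fun i => (g i).continuous,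
    fun i q => ?_, fun x => ?_⟩
  · refine Fin.addCases (fun q => ?_) (fun j => ?_) q
    · simp only [Fin.append_left]; fun_prop
    · simp only [Fin.append_right]; fun_prop
  · have hmem : ∀ j, (u j x + R) / (2 * R) ∈ unitInterval := fun j => by
      obtain ⟨h1, h2⟩ := abs_le.mp (huR j x)
      exact ⟨div_nonneg (by linarith) (by linarith), (div_le_one (by linarith)).mpr (by linarith)⟩
    have h := hg (Fin.append x fun j => ⟨(u j x + R) / (2 * R), hmem j⟩)
    have hcancel : ∀ j, 2 * R * ((u j x + R) / (2 * R)) - R = u j x := fun j => by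
      field_simp; ring
    have hx : ∀ q, proj (x q) = x q := fun q => Set.projIcc_val _ _
    have hv : ∀ j, proj ((u j x + R) / (2 * R)) = ⟨_, hmem j⟩ := fun j =>
      Set.projIcc_of_mem _ (hmem j)
    simpa only [ContinuousMap.coe_mk, Fin.append_left, Fin.append_right, hcancel,
      Fin.sum_univ_add, hx, hv] using h
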